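/- Let $N\ge 3$ be an integer, and let $A>0$, $0<\alpha<2$ and $$\frac{2N}{N-\alpha}<p\le 2\,\frac{2N-2+\alpha}{2N-2-\alpha}.$$ Then there is no radial classical solution of the problem $$-\Delta u+\frac{A}{|x|^{\alpha}}\,u=u^{p-1}\ \text{ and }\ u>0\ \text{ in } \mathbb{R}^N\setminus\{0\},\qquad u\in D^{1,2}(\mathbb{R}^N)\cap L^2(\mathbb{R}^N,|x|^{-\alpha}dx)\cap L^p(\mathbb{R}^N),$$ that is, there is no radial function $u\in C^2(\mathbb{R}^N\setminus\{0\})$ which satisfies the equation and the inequality at every point of $\mathbb{R}^N\setminus\{0\}$ and belongs to the three spaces. Here radial means that $u(x)=\phi(|x|)$ for $x\neq 0$, for some function $\phi$ of one variable, and $D^{1,2}(\mathbb{R}^N)=\{u\in L^{2N/(N-2)}(\mathbb{R}^N):\nabla u\in L^2(\mathbb{R}^N)\}$, with $\nabla u$ the weak gradient on $\mathbb{R}^N$. -/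

import Mathlib

open MeasureTheory
open scoped ContDiff Laplacian

/-- Euclidean space `ℝ^N`. -/
abbrev EucSpace (N : ℕ) : Type := EuclideanSpace ℝ (Fin N)

/-- `G` is the weak (distributional) gradient of `u` on all of `ℝ^N`: both are locally integrable
and `∫ u ∂_v φ = - ∫ ⟨G, v⟩ φ` for every `φ ∈ C_c^∞(ℝ^N)` and every direction `v`. -/
def HasWeakGradient {N : ℕ} (u : EucSpace N → ℝ) (G : EucSpace N → EucSpace N) : Prop :=
  LocallyIntegrable u volume ∧ LocallyIntegrable G volume ∧
    ∀ φ : EucSpace N → ℝ, ContDiff ℝ ∞ φ → HasCompactSupport φ → ∀ v : EucSpace N,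
      ∫ x, u x * fderiv ℝ φ x v = - ∫ x, inner ℝ (G x) v * φ x

/-- `u ∈ D^{1,2}(ℝ^N)`: `u ∈ L^{2N/(N-2)}(ℝ^N)` with weak gradient in `L^2(ℝ^N)`
(meant for `N ≥ 3`). -/
def MemD12 {N : ℕ} (u : EucSpace N → ℝ) : Prop :=
  MemLp u (ENNReal.ofReal (2 * (N : ℝ) / ((N : ℝ) - 2))) volume ∧
    ∃ G : EucSpace N → EucSpace N, HasWeakGradient u G ∧ MemLp G 2 volume

/-- `u ∈ L^2(ℝ^N, |x|^{-α} dx)`. -/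
def MemL2Weighted {N : ℕ} (α : ℝ) (u : EucSpace N → ℝ) : Prop :=
  MemLp u 2 (volume.withDensity fun x : EucSpace N => ENNReal.ofReal (‖x‖ ^ (-α)))

/-- `u` is a classical solution of
`-Δu + A |x|^{-α} u = u^{p-1}`, `u > 0` in `ℝ^N \ {0}`,
`u ∈ D^{1,2}(ℝ^N) ∩ L^2(ℝ^N, |x|^{-α} dx) ∩ L^p(ℝ^N)`.
The value of `u` at the origin plays no role. -/
structure IsClassicalSolution {N : ℕ} (A α p : ℝ) (u : EucSpace N → ℝ) : Prop where
  contDiffOn : ContDiffOn ℝ 2 u {0}ᶜ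
  equation : ∀ x : EucSpace N, x ≠ 0 → -(Δ u x) + A / ‖x‖ ^ α * u x = u x ^ (p - 1)
  pos : ∀ x : EucSpace N, x ≠ 0 → 0 < u x
  memD12 : MemD12 u
  memL2Weighted : MemL2Weighted α u
  memLp : MemLp u (ENNReal.ofReal p) volume

/-- `u` is radial on `ℝ^N \ {0}`: `u x = f |x|` for some function `f` of one variable. -/
def IsRadial {N : ℕ} (u : EucSpace N → ℝ) : Prop :=
  ∃ f : ℝ → ℝ, ∀ x : EucSpace N, x ≠ 0 → u x = f ‖x‖

/-! Put k = (2n-2-α)/4, β = 1-α/2, c = ((n-2)²-β²)/4 > 0, v = r^k f and dt = r^(-α/2) dr. The radial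
equation becomes v_tt = (A + c r^(-2β)) v - r^(α-k(p-2)) v^(p-1), with a constant coefficient on the
A term. Its energy v_t² - (A + c r^(-2β)) v² + (2/p) r^(α-k(p-2)) v^p, which is `radialEnergy`,
strictly increases: r^(-2β) decreases, and the upper bound on p says exactly that α - k(p-2) ≥ 0.
Integrability at infinity makes the energy nonpositive (`radialEnergy_nonpos`), hence at most some
-δ < 0 on (0, 1]; this forces r^(k-β) f ≥ η > 0 there. The finite Dirichlet integral gives f ≤ C
r^(-(n-2)/2) (`exists_le_rpow`), so the nonlinear term is negligible near 0. The r-derivative of v_t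
(`radialSlope`) is then at least a constant times 1/r, so v_t → -∞ at 0 and v decreases near 0. But
0 < v ≤ C r^(β/2) → 0 as r → 0, a contradiction. -/

/-- `f` is a positive solution on `(0, ∞)`, with derivative `g`, of the radial form
`f'' + (n-1)/r f' - A r^{-α} f + f^{p-1} = 0` of the equation in dimension `n`. -/
structure IsRadialProfile (n A α p : ℝ) (f g : ℝ → ℝ) : Prop where
  pos : ∀ r, 0 < r → 0 < f r
  hasDerivAt : ∀ r, 0 < r → HasDerivAt f (g r) r
  ode : ∀ r, 0 < r →
    HasDerivAt g (A * r ^ (-α) * f r - f r ^ (p - 1) - (n - 1) / r * g r) r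

/-- The energy which is monotone along radial profiles. -/
noncomputable def radialEnergy (n A α p : ℝ) (f g : ℝ → ℝ) (r : ℝ) : ℝ :=
  r ^ (n - 1 + α / 2) * (g r ^ 2 + 2 * ((2 * n - 2 - α) / 4) * (f r * g r / r)
    + (2 * n - 2 - α) / 4 * (1 - α / 2) * (f r ^ 2 / r ^ 2) - A * r ^ (-α) * f r ^ 2
    + 2 / p * f r ^ p)

/-- The derivative of `r ^ k * f r`, where `k = (2n-2-α)/4`, up to a power of `r`. -/
noncomputable def radialSlope (n α : ℝ) (f g : ℝ → ℝ) (r : ℝ) : ℝ :=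
  r ^ ((2 * n - 2 - α) / 4 - (1 - α / 2)) * ((2 * n - 2 - α) / 4 * f r + r * g r)

/-! ### Analysis of the radial ODE. -/

namespace IsRadialProfile

variable {n A α p : ℝ} {f g : ℝ → ℝ}

theorem hasDerivAt_radialEnergy (h : IsRadialProfile n A α p f g) (hp : p ≠ 0) {r : ℝ}
    (hr : 0 < r) :
    HasDerivAt (radialEnergy n A α p f g)
      (r ^ (n - 1 + α / 2) * (((n - 2) ^ 2 - (1 - α / 2) ^ 2) * (1 - α / 2) / 2 * (f r ^ 2 / r ^ 3)
        + 2 * (α - (2 * n - 2 - α) / 4 * (p - 2)) / p * (f r ^ p / r))) r := by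
  have hf0 : f r ≠ 0 := (h.pos r hr).ne'
  have hr0 : r ≠ 0 := hr.ne'
  have hf := h.hasDerivAt r hr
  have hg := h.ode r hr
  have hfp := hf.rpow_const (p := p) (Or.inl hf0)
  have hX := Real.hasDerivAt_rpow_const (x := r) (p := n - 1 + α / 2) (Or.inl hr0)
  have hq := Real.hasDerivAt_rpow_const (x := r) (p := -α) (Or.inl hr0)
  have hid := hasDerivAt_id' r
  rw [Real.rpow_sub_one hr0] at hX hq
  rw [Real.rpow_sub_one hf0] at hg hfp
  have key := hX.mul (((((hg.pow 2).add (((hf.mul hg).div hid hr0).const_mul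
    (2 * ((2 * n - 2 - α) / 4)))).add (((hf.pow 2).div (hid.pow 2) (pow_ne_zero 2 hr0)).const_mul
      ((2 * n - 2 - α) / 4 * (1 - α / 2)))).sub ((hq.const_mul A).mul (hf.pow 2))).add
        (hfp.const_mul (2 / p)))
  refine key.congr_deriv ?_
  simp only [Pi.add_apply, Pi.mul_apply, Pi.div_apply, Pi.sub_apply, Pi.pow_apply]
  generalize r ^ (n - 1 + α / 2) = X
  generalize r ^ (-α) = q
  generalize f r ^ p = F
  field_simp
  ring

theorem hasDerivAt_radialSlope (h : IsRadialProfile n A α p f g) {r : ℝ} (hr : 0 < r) :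
    HasDerivAt (radialSlope n α f g)
      (r ^ ((2 * n - 2 - α) / 4 - (1 - α / 2)) * f r / r *
        (((n - 2) ^ 2 - (1 - α / 2) ^ 2) / 4 + A * r ^ (-α) * r ^ 2 - r ^ 2 * f r ^ (p - 2))) r := by
  have hf0 : f r ≠ 0 := (h.pos r hr).ne'
  have hr0 : r ≠ 0 := hr.ne'
  have hf := h.hasDerivAt r hr
  have hg := h.ode r hr
  have hX := Real.hasDerivAt_rpow_const (x := r) (p := (2 * n - 2 - α) / 4 - (1 - α / 2))
    (Or.inl hr0)
  have hid := hasDerivAt_id' r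
  rw [Real.rpow_sub_one hr0] at hX
  have hp1 : f r ^ (p - 1) = f r ^ (p - 2) * f r := by
    rw [← Real.rpow_add_one hf0]; congr 1; ring
  rw [hp1] at hg
  have key := hX.mul ((hf.const_mul ((2 * n - 2 - α) / 4)).add (hid.mul hg))
  refine key.congr_deriv ?_
  simp only [Pi.add_apply, Pi.mul_apply]
  generalize r ^ ((2 * n - 2 - α) / 4 - (1 - α / 2)) = X
  generalize r ^ (-α) = q
  generalize f r ^ (p - 2) = F
  field_simp
  ring

theorem hasDerivAt_rpow_mul (h : IsRadialProfile n A α p f g) (k : ℝ) {r : ℝ} (hr : 0 < r) :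
    HasDerivAt (fun r => r ^ k * f r) (r ^ k / r * (k * f r + r * g r)) r := by
  have hr0 : r ≠ 0 := hr.ne'
  have hX := Real.hasDerivAt_rpow_const (x := r) (p := k) (Or.inl hr0)
  rw [Real.rpow_sub_one hr0] at hX
  refine (hX.mul (h.hasDerivAt r hr)).congr_deriv ?_
  field_simp

/-- Completing the square writes the energy as the squared slope, plus a nonnegative f^p term, minus
the quadratic term kept here. -/
theorem neg_le_radialEnergy (h : IsRadialProfile n A α p f g) (hp : 0 < p) {r : ℝ}
    (hr : 0 < r) :
    -((((n - 2) ^ 2 - (1 - α / 2) ^ 2) / 4 + A * r ^ (-α) * r ^ 2) *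
      (r ^ ((2 * n - 2 - α) / 4 - (1 - α / 2)) * f r) ^ 2) ≤ radialEnergy n A α p f g r := by
  have hr0 : r ≠ 0 := hr.ne'
  have hX : r ^ (n - 1 + α / 2) = (r ^ ((2 * n - 2 - α) / 4 - (1 - α / 2))) ^ 2 * r ^ 2 := by
    rw [← Real.rpow_natCast, ← Real.rpow_natCast, ← Real.rpow_mul hr.le, ← Real.rpow_add hr]
    congr 1; push_cast; ring
  have hF : 0 ≤ 2 / p * f r ^ p := mul_nonneg (by positivity)
    (Real.rpow_nonneg (h.pos r hr).le _)
  rw [radialEnergy, hX]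
  generalize r ^ ((2 * n - 2 - α) / 4 - (1 - α / 2)) = X
  generalize r ^ (-α) = q
  generalize 2 / p * f r ^ p = F at hF
  have : X ^ 2 * r ^ 2 * (g r ^ 2 + 2 * ((2 * n - 2 - α) / 4) * (f r * g r / r)
      + (2 * n - 2 - α) / 4 * (1 - α / 2) * (f r ^ 2 / r ^ 2) - A * q * f r ^ 2 + F)
      = (X * ((2 * n - 2 - α) / 4 * f r + r * g r)) ^ 2 + X ^ 2 * r ^ 2 * F
        - (((n - 2) ^ 2 - (1 - α / 2) ^ 2) / 4 + A * q * r ^ 2) * (X * f r) ^ 2 := by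
    field_simp
    ring
  rw [this]
  have : 0 ≤ X ^ 2 * r ^ 2 * F := by positivity
  nlinarith [sq_nonneg (X * ((2 * n - 2 - α) / 4 * f r + r * g r))]

theorem strictMonoOn_radialEnergy (h : IsRadialProfile n A α p f g) (hn : 3 ≤ n) (hα0 : 0 < α)
    (hα2 : α < 2) (hp0 : 0 < p) (hp : (2 * n - 2 - α) / 4 * (p - 2) ≤ α) :
    StrictMonoOn (radialEnergy n A α p f g) (Set.Ioi 0) := by
  apply strictMonoOn_of_deriv_pos (convex_Ioi 0)
  · intro r hr
    exact (h.hasDerivAt_radialEnergy hp0.ne' hr).continuousAt.continuousWithinAt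
  · intro r hr
    rw [interior_Ioi] at hr
    have hr' : 0 < r := hr
    have hf := h.pos r hr'
    rw [(h.hasDerivAt_radialEnergy hp0.ne' hr').deriv]
    apply mul_pos (Real.rpow_pos_of_pos hr' _)
    apply add_pos_of_pos_of_nonneg
    · have : 0 < (n - 2) ^ 2 - (1 - α / 2) ^ 2 := by nlinarith
      have : 0 < 1 - α / 2 := by linarith
      positivity
    · have : 0 ≤ α - (2 * n - 2 - α) / 4 * (p - 2) := by linarith
      positivity

/-- A positive value ε would persist to the right by monotonicity. But r^(-α/2) times the energy is
bounded by the three integrable densities, whereas ε r^(-α/2) is not integrable at infinity since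
α/2 < 1. -/
theorem radialEnergy_nonpos (h : IsRadialProfile n A α p f g) (hn : 3 ≤ n) (hA : 0 < A)
    (hα0 : 0 < α) (hα2 : α < 2) (hp0 : 0 < p) (hp : (2 * n - 2 - α) / 4 * (p - 2) ≤ α)
    (hg2 : IntegrableOn (fun r => r ^ (n - 1) * g r ^ 2) (Set.Ioi 0))
    (hf2 : IntegrableOn (fun r => r ^ (n - 1) * (r ^ (-α) * f r ^ 2)) (Set.Ioi 0))
    (hfp : IntegrableOn (fun r => r ^ (n - 1) * f r ^ p) (Set.Ioi 0)) {r₀ : ℝ} (hr₀ : 0 < r₀) :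
    radialEnergy n A α p f g r₀ ≤ 0 := by
  by_contra! hpos
  set ε := radialEnergy n A α p f g r₀
  set k := (2 * n - 2 - α) / 4 with hk
  have hk0 : 0 < k := by rw [hk]; linarith
  have hβ : 0 < 1 - α / 2 := by linarith
  -- Beyond 1, r^(-2) ≤ r^(-α), so the f g / r and f² / r² terms are controlled by the weighted L²
  -- density.
  set R := max r₀ 1
  have hR : 0 < R := lt_max_of_lt_left hr₀
  have hsub : Set.Ioi R ⊆ Set.Ioi 0 := Set.Ioi_subset_Ioi hR.le
  have hD := ((((hg2.mono_set hsub).const_mul (1 + k)).add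
    ((hf2.mono_set hsub).const_mul (k + k * (1 - α / 2)))).add
      ((hfp.mono_set hsub).const_mul (2 / p)))
  have hint : IntegrableOn (fun r : ℝ => ε * r ^ (-(α / 2))) (Set.Ioi R) := by
    refine hD.mono' ?_ ?_
    · exact (ContinuousOn.mul continuousOn_const (fun x hx =>
        (Real.continuousAt_rpow_const x _ (Or.inl (hR.trans hx).ne')).continuousWithinAt)).aestronglyMeasurable
          measurableSet_Ioi
    · refine (ae_restrict_iff' measurableSet_Ioi).2 (Filter.Eventually.of_forall fun r hr => ?_)
      have hr0 : 0 < r := hR.trans hr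
      have hr1 : 1 ≤ r := (le_max_right r₀ 1).trans (le_of_lt hr)
      have hmono : ε ≤ radialEnergy n A α p f g r :=
        (h.strictMonoOn_radialEnergy hn hα0 hα2 hp0 hp).monotoneOn hr₀ hr0
          ((le_max_left r₀ 1).trans (le_of_lt hr))
      have hf := h.pos r hr0
      rw [Real.norm_of_nonneg (by positivity)]
      have hX : r ^ (n - 1 + α / 2) = r ^ (n - 1) * r ^ (α / 2) := Real.rpow_add hr0 _ _
      have hc : r ^ (α / 2) * r ^ (-(α / 2)) = 1 := by
        rw [← Real.rpow_add hr0]; simp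
      have hw : 0 < r ^ (-(α / 2)) := by positivity
      have hq : 1 / r ^ 2 ≤ r ^ (-α) := by
        rw [one_div, ← Real.rpow_natCast, ← Real.rpow_neg hr0.le]
        exact Real.rpow_le_rpow_of_exponent_le hr1 (by push_cast; linarith)
      have hfg : 2 * (f r * g r / r) ≤ g r ^ 2 + r ^ (-α) * f r ^ 2 := by
        have h1 : 2 * (f r * g r / r) ≤ g r ^ 2 + 1 / r ^ 2 * f r ^ 2 := by
          have := sq_nonneg (g r - f r / r)
          have e : (g r - f r / r) ^ 2 = g r ^ 2 + 1 / r ^ 2 * f r ^ 2 - 2 * (f r * g r / r) := by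
            field_simp; ring
          linarith
        nlinarith [sq_nonneg (f r)]
      have hff : f r ^ 2 / r ^ 2 ≤ r ^ (-α) * f r ^ 2 := by
        rw [div_eq_mul_one_div, mul_comm]; gcongr
      calc ε * r ^ (-(α / 2)) ≤ radialEnergy n A α p f g r * r ^ (-(α / 2)) := by gcongr
        _ = r ^ (n - 1) * (g r ^ 2 + k * (2 * (f r * g r / r))
            + k * (1 - α / 2) * (f r ^ 2 / r ^ 2) - A * r ^ (-α) * f r ^ 2 + 2 / p * f r ^ p) := by
          rw [radialEnergy, hX, ← hk]
          linear_combination (r ^ (n - 1) * (g r ^ 2 + k * (2 * (f r * g r / r))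
            + k * (1 - α / 2) * (f r ^ 2 / r ^ 2) - A * r ^ (-α) * f r ^ 2 + 2 / p * f r ^ p)) * hc
        _ ≤ r ^ (n - 1) * (g r ^ 2 + k * (g r ^ 2 + r ^ (-α) * f r ^ 2)
            + k * (1 - α / 2) * (r ^ (-α) * f r ^ 2) - 0 + 2 / p * f r ^ p) := by
          gcongr
          positivity
        _ = _ := by simp only [Pi.add_apply]; ring
  have hint' : IntegrableOn (fun r : ℝ => r ^ (-(α / 2))) (Set.Ioi R) := by
    have := hint.const_mul ε⁻¹
    refine this.congr (Filter.Eventually.of_forall fun r => ?_)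
    simp only
    rw [inv_mul_cancel_left₀ hpos.ne']
  rw [integrableOn_Ioi_rpow_iff hR] at hint'
  linarith

/-- The radial bound `f ≤ C r^{-(n-2)/2}` near the origin. -/
theorem exists_le_rpow (h : IsRadialProfile n A α p f g) (hn : 3 ≤ n)
    (hg2 : IntegrableOn (fun r => r ^ (n - 1) * g r ^ 2) (Set.Ioi 0)) :
    ∃ C, 0 < C ∧ ∀ r, 0 < r → r ≤ 1 → f r ≤ C * r ^ (-((n - 2) / 2)) := by
  set K := ∫ r in Set.Ioi 0, r ^ (n - 1) * g r ^ 2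
  have hK : 0 ≤ K := setIntegral_nonneg measurableSet_Ioi fun r hr =>
    mul_nonneg (Real.rpow_nonneg (le_of_lt hr) _) (sq_nonneg _)
  have hf1 := h.pos 1 one_pos
  refine ⟨f 1 + (K + 1), by linarith, fun r hr hr1 => ?_⟩
  -- This weight in Young's inequality balances the two resulting terms: each is O(l⁻¹), because
  -- ∫_r^1 x^(-(n-1)) dx ≤ l⁻².
  set l := r ^ ((n - 2) / 2) with hl
  have hl0 : 0 < l := Real.rpow_pos_of_pos hr _
  have hlinv : r ^ (-((n - 2) / 2)) = l⁻¹ := Real.rpow_neg hr.le _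
  have hl1 : l ≤ 1 := Real.rpow_le_one hr.le hr1 (by linarith)
  have hgc : ContinuousOn g (Set.Icc r 1) := fun x hx =>
    (h.ode x (hr.trans_le hx.1)).continuousAt.continuousWithinAt
  have hrc : ∀ s : ℝ, ContinuousOn (fun x : ℝ => x ^ s) (Set.Icc r 1) := fun s x hx =>
    (Real.continuousAt_rpow_const x _ (Or.inl (hr.trans_le hx.1).ne')).continuousWithinAt
  have hgi : IntervalIntegrable (fun x => -g x) volume r 1 :=
    (hgc.neg.mono (by rw [Set.uIcc_of_le hr1])).intervalIntegrable
  have h1i : IntervalIntegrable (fun x => x ^ (n - 1) * g x ^ 2) volume r 1 :=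
    (((hrc _).mul (hgc.pow 2)).mono (by rw [Set.uIcc_of_le hr1])).intervalIntegrable
  have h2i : IntervalIntegrable (fun x : ℝ => x ^ (-(n - 1))) volume r 1 :=
    ((hrc _).mono (by rw [Set.uIcc_of_le hr1])).intervalIntegrable
  have hftc : ∫ x in r..1, -g x = -f 1 - -f r :=
    intervalIntegral.integral_eq_sub_of_hasDerivAt (f := fun x => -f x) (fun x hx => by
      rw [Set.uIcc_of_le hr1] at hx
      exact (h.hasDerivAt x (hr.trans_le hx.1)).neg) hgi
  have hle : ∫ x in r..1, -g x ≤
      ∫ x in r..1, (l⁻¹ * (x ^ (n - 1) * g x ^ 2) + l * x ^ (-(n - 1))) := by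
    refine intervalIntegral.integral_mono_on hr1 hgi
      ((h1i.const_mul _).add (h2i.const_mul _)) fun x hx => ?_
    have hx0 : 0 < x := hr.trans_le hx.1
    have hX : 0 < x ^ (n - 1) := Real.rpow_pos_of_pos hx0 _
    rw [Real.rpow_neg hx0.le]
    generalize x ^ (n - 1) = X at hX
    have e : l⁻¹ * (X * g x ^ 2) + l * X⁻¹ + g x
        = l⁻¹ * X * ((g x + l * X⁻¹ / 2) ^ 2 + 3 / 4 * (l * X⁻¹) ^ 2) := by
      field_simp; ring
    have : 0 ≤ l⁻¹ * X * ((g x + l * X⁻¹ / 2) ^ 2 + 3 / 4 * (l * X⁻¹) ^ 2) := by positivity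
    linarith
  rw [intervalIntegral.integral_add (h1i.const_mul _) (h2i.const_mul _),
    intervalIntegral.integral_const_mul, intervalIntegral.integral_const_mul] at hle
  have hI1 : ∫ x in r..1, x ^ (n - 1) * g x ^ 2 ≤ K := by
    rw [intervalIntegral.integral_of_le hr1]
    refine setIntegral_mono_set hg2 ?_
      (Filter.Eventually.of_forall (Set.Ioc_subset_Ioi_self.trans (Set.Ioi_subset_Ioi hr.le)))
    exact (ae_restrict_iff' measurableSet_Ioi).2 (Filter.Eventually.of_forall fun x hx =>
      mul_nonneg (Real.rpow_nonneg (le_of_lt hx) _) (sq_nonneg _))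
  have hI2 : l * ∫ x in r..1, x ^ (-(n - 1)) ≤ l⁻¹ := by
    rw [integral_rpow (Or.inr ⟨by linarith, by
      rw [Set.uIcc_of_le hr1]; exact fun hh => absurd hh.1 (not_le.2 hr)⟩)]
    have e : r ^ (-(n - 1) + 1) = l⁻¹ ^ 2 := by
      rw [hl, ← Real.rpow_neg hr.le, ← Real.rpow_natCast, ← Real.rpow_mul hr.le]
      congr 1; push_cast; ring
    rw [e, Real.one_rpow]
    have : (1 - l⁻¹ ^ 2) / (-(n - 1) + 1) ≤ l⁻¹ ^ 2 := by
      rw [div_le_iff_of_neg (by linarith)]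
      nlinarith [sq_nonneg l⁻¹]
    calc _ ≤ l * l⁻¹ ^ 2 := by gcongr
      _ = l⁻¹ := by field_simp
  have h1l : 1 ≤ l⁻¹ := (one_le_inv₀ hl0).2 hl1
  have : l⁻¹ * ∫ x in r..1, x ^ (n - 1) * g x ^ 2 ≤ l⁻¹ * K := by gcongr
  rw [hlinv]
  nlinarith

/-- There is no radial profile with finite weighted energy in the given range of exponents. -/
theorem false_of_integrableOn (h : IsRadialProfile n A α p f g) (hn : 3 ≤ n) (hA : 0 < A)
    (hα0 : 0 < α) (hα2 : α < 2) (hp2 : 2 < p) (hp : (2 * n - 2 - α) / 4 * (p - 2) ≤ α)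
    (hg2 : IntegrableOn (fun r => r ^ (n - 1) * g r ^ 2) (Set.Ioi 0))
    (hf2 : IntegrableOn (fun r => r ^ (n - 1) * (r ^ (-α) * f r ^ 2)) (Set.Ioi 0))
    (hfp : IntegrableOn (fun r => r ^ (n - 1) * f r ^ p) (Set.Ioi 0)) : False := by
  have hp0 : 0 < p := by linarith
  have hmono := h.strictMonoOn_radialEnergy hn hα0 hα2 hp0 hp
  obtain ⟨C, hC, hfC⟩ := h.exists_le_rpow hn hg2
  set k := (2 * n - 2 - α) / 4 with hk
  set β := 1 - α / 2 with hβ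
  have hβ0 : 0 < β := by linarith
  set c := ((n - 2) ^ 2 - β ^ 2) / 4 with hc
  have hc0 : 0 < c := by
    have : 0 < (n - 2) ^ 2 - β ^ 2 := by nlinarith
    positivity
  -- the energy stays away from zero near the origin
  obtain ⟨δ, hδ, hJδ⟩ : ∃ δ, 0 < δ ∧ ∀ r, 0 < r → r ≤ 1 → radialEnergy n A α p f g r ≤ -δ := by
    -- Nonpositivity at 2 and strict monotonicity make the energy at 1 strictly negative.
    have h2 := h.radialEnergy_nonpos hn hA hα0 hα2 hp0 hp hg2 hf2 hfp (two_pos)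
    have h1 := hmono (Set.mem_Ioi.2 one_pos) (Set.mem_Ioi.2 two_pos) one_lt_two
    exact ⟨-radialEnergy n A α p f g 1, by linarith, fun r hr hr1 => by
      rw [neg_neg]; exact hmono.monotoneOn (Set.mem_Ioi.2 hr) (Set.mem_Ioi.2 one_pos) hr1⟩
  obtain ⟨η, hη, hfη⟩ : ∃ η, 0 < η ∧ ∀ r, 0 < r → r ≤ 1 → η ≤ r ^ (k - β) * f r := by
    refine ⟨√(δ / (c + A)), by positivity, fun r hr hr1 => ?_⟩
    have hf := h.pos r hr
    apply Real.sqrt_le_iff.2 ⟨by positivity, ?_⟩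
    rw [div_le_iff₀ (by positivity)]
    have h1 := (h.neg_le_radialEnergy hp0 hr).trans (hJδ r hr hr1)
    have h2 : r ^ (-α) * r ^ 2 ≤ 1 := by
      rw [← Real.rpow_natCast, ← Real.rpow_add hr]
      exact Real.rpow_le_one hr.le hr1 (by push_cast; linarith)
    have h3 : c + A * r ^ (-α) * r ^ 2 ≤ c + A := by nlinarith
    rw [← hk, ← hβ, ← hc] at h1
    have h4 : (c + A * r ^ (-α) * r ^ 2) * (r ^ (k - β) * f r) ^ 2
      ≤ (c + A) * (r ^ (k - β) * f r) ^ 2 := by gcongr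
    linarith
  -- the nonlinear term is negligible near the origin
  obtain ⟨R, hR0, hR1, hR⟩ : ∃ R, 0 < R ∧ R ≤ 1 ∧
      ∀ r, 0 < r → r ≤ R → r ^ 2 * f r ^ (p - 2) ≤ c / 2 := by
    set e := 2 - (n - 2) / 2 * (p - 2) with he
    -- Equivalent to p < 2n/(n-2): the upper bound on p is Sobolev-subcritical because α < 2.
    have he0 : 0 < e := by
      have h1 : (n - 2) * α < 2 * n - 2 - α := by nlinarith
      have h2 : (n - 2) * ((2 * n - 2 - α) / 4 * (p - 2)) ≤ (n - 2) * α := by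
        gcongr; linarith
      have h3 : (2 * n - 2 - α) * e > 0 := by
        rw [he]; rw [hk] at *; nlinarith
      exact pos_of_mul_pos_right h3 (by linarith)
    have hlim : Filter.Tendsto (fun r : ℝ => C ^ (p - 2) * r ^ e) (nhds 0) (nhds 0) := by
      have := (Real.continuousAt_rpow_const (0 : ℝ) e (Or.inr he0.le)).tendsto.const_mul
        (C ^ (p - 2))
      rwa [Real.zero_rpow he0.ne', mul_zero] at this
    obtain ⟨ρ, hρ, hρ'⟩ := Metric.eventually_nhds_iff.1 (hlim.eventually_lt_const (half_pos hc0))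
    refine ⟨min (ρ / 2) 1, by positivity, min_le_right _ _, fun r hr hrR => ?_⟩
    have hrρ : r < ρ := by linarith [min_le_left (ρ / 2) 1]
    have h1 := hρ' (y := r) (by rwa [Real.dist_0_eq_abs, abs_of_pos hr])
    have hf := h.pos r hr
    calc r ^ 2 * f r ^ (p - 2) ≤ r ^ 2 * (C * r ^ (-((n - 2) / 2))) ^ (p - 2) := by
          gcongr
          exact hfC r hr (hrR.trans (min_le_right _ _))
      _ = C ^ (p - 2) * r ^ e := by
          rw [Real.mul_rpow hC.le (by positivity), ← Real.rpow_mul hr.le, mul_left_comm,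
            ← Real.rpow_natCast, ← Real.rpow_add hr]
          congr 2
          rw [he]; push_cast; ring
      _ ≤ c / 2 := h1.le
  -- the slope is below a logarithm
  have hslope : ∀ r, 0 < r → r ≤ R →
      radialSlope n α f g r - c / 2 * η * Real.log r ≤
        radialSlope n α f g R - c / 2 * η * Real.log R := by
    have hderiv : ∀ r, 0 < r → HasDerivAt (fun r => radialSlope n α f g r - c / 2 * η * Real.log r)
        _ r := fun r hr => (h.hasDerivAt_radialSlope hr).sub
          ((Real.hasDerivAt_log hr.ne').const_mul (c / 2 * η))
    have : MonotoneOn (fun r => radialSlope n α f g r - c / 2 * η * Real.log r) (Set.Ioc 0 R) := by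
      apply monotoneOn_of_deriv_nonneg (convex_Ioc 0 R)
      · exact fun r hr => (hderiv r hr.1).continuousAt.continuousWithinAt
      · exact fun r hr => (hderiv r
          (interior_subset hr).1).differentiableAt.differentiableWithinAt
      · intro r hr
        have hr := interior_subset hr
        have hr0 : 0 < r := hr.1
        rw [(hderiv r hr0).deriv, ← hk, ← hβ, ← hc]
        have h1 := hfη r hr.1 (hr.2.trans hR1)
        have h2 := hR r hr.1 hr.2
        have h3 : 0 ≤ A * r ^ (-α) * r ^ 2 := by positivity
        have h4 : η * (c / 2) ≤ r ^ (k - β) * f r *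
            (c + A * r ^ (-α) * r ^ 2 - r ^ 2 * f r ^ (p - 2)) := by
          exact mul_le_mul h1 (by linarith) (by positivity) (hη.le.trans h1)
        have h5 : r ^ (k - β) * f r / r * (c + A * r ^ (-α) * r ^ 2 - r ^ 2 * f r ^ (p - 2))
            - c / 2 * η * r⁻¹ = (r ^ (k - β) * f r *
            (c + A * r ^ (-α) * r ^ 2 - r ^ 2 * f r ^ (p - 2)) - η * (c / 2)) / r := by
          field_simp
        rw [h5]
        exact div_nonneg (by linarith) hr0.le
    exact fun r hr hrR => this ⟨hr, hrR⟩ ⟨hR0, le_rfl⟩ hrR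
  obtain ⟨r₁, hr₁, hneg⟩ : ∃ r₁, 0 < r₁ ∧ ∀ r, 0 < r → r ≤ r₁ → radialSlope n α f g r < 0 := by
    have hlim := Real.tendsto_log_nhdsGT_zero.const_mul_atBot (show 0 < c / 2 * η by positivity)
    have hev := hlim.eventually_lt_atBot
      (-(radialSlope n α f g R - c / 2 * η * Real.log R))
    obtain ⟨ρ, hρ, hρ'⟩ := mem_nhdsGT_iff_exists_Ioc_subset.1 hev
    refine ⟨min ρ R, lt_min hρ hR0, fun r hr hrR => ?_⟩
    have h1 : c / 2 * η * Real.log r < _ := hρ' ⟨hr, hrR.trans (min_le_left _ _)⟩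
    have h2 := hslope r hr (hrR.trans (min_le_right _ _))
    linarith
  have hanti : AntitoneOn (fun r => r ^ k * f r) (Set.Ioc 0 r₁) := by
    apply antitoneOn_of_deriv_nonpos (convex_Ioc 0 r₁)
    · exact fun r hr => (h.hasDerivAt_rpow_mul k hr.1).continuousAt.continuousWithinAt
    · exact fun r hr => (h.hasDerivAt_rpow_mul k
        (interior_subset hr).1).differentiableAt.differentiableWithinAt
    · intro r hr
      have hr := interior_subset hr
      have hr0 : 0 < r := hr.1
      rw [(h.hasDerivAt_rpow_mul k hr0).deriv]
      have h1 := hneg r hr.1 hr.2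
      rw [radialSlope, ← hk, ← hβ] at h1
      have h2 := (neg_of_mul_neg_right h1 (by positivity)).le
      exact mul_nonpos_of_nonneg_of_nonpos (by positivity) h2
  have hlim : Filter.Tendsto (fun r : ℝ => C * r ^ (β / 2)) (nhdsWithin 0 (Set.Ioi 0)) (nhds 0) := by
    have := (Real.continuousAt_rpow_const (0 : ℝ) (β / 2) (Or.inr (by positivity))).tendsto.const_mul C
    rw [Real.zero_rpow (by positivity), mul_zero] at this
    exact this.mono_left nhdsWithin_le_nhds
  -- Let r → 0 in v(r₁) ≤ v(r) ≤ C r^(β/2), using k - (n-2)/2 = β/2.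
  have hle : r₁ ^ k * f r₁ ≤ 0 := by
    refine ge_of_tendsto hlim ?_
    have hmem : Set.Ioc 0 (min r₁ 1) ∈ nhdsWithin (0 : ℝ) (Set.Ioi 0) :=
      Ioc_mem_nhdsGT (by positivity)
    filter_upwards [hmem] with r hr
    have hr0 : 0 < r := hr.1
    have hr1 : r ≤ r₁ := hr.2.trans (min_le_left _ _)
    calc r₁ ^ k * f r₁ ≤ r ^ k * f r := hanti ⟨hr0, hr1⟩ ⟨hr₁, le_rfl⟩ hr1
      _ ≤ r ^ k * (C * r ^ (-((n - 2) / 2))) := by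
        gcongr; exact hfC r hr0 (hr.2.trans (min_le_right _ _))
      _ = C * r ^ (β / 2) := by
        rw [mul_left_comm, ← Real.rpow_add hr0]
        congr 2
        rw [hk, hβ]; ring
  have : 0 < r₁ ^ k * f r₁ := mul_pos (Real.rpow_pos_of_pos hr₁ _) (h.pos _ hr₁)
  linarith

end IsRadialProfile

/-! ### Calculus of radial functions. -/

section Radial

variable {E : Type*} [NormedAddCommGroup E] [InnerProductSpace ℝ E] {u : E → ℝ} {f : ℝ → ℝ}

theorem contDiffOn_profile {e : E} (he : ‖e‖ = 1) (hu : ContDiffOn ℝ 2 u {0}ᶜ)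
    (huf : ∀ x, x ≠ 0 → u x = f ‖x‖) : ContDiffOn ℝ 2 f (Set.Ioi 0) := by
  have he0 : e ≠ 0 := by rintro rfl; simp at he
  have h : ContDiffOn ℝ 2 (fun t : ℝ => u (t • e)) (Set.Ioi 0) :=
    hu.comp (contDiff_id.smul contDiff_const).contDiffOn fun t (ht : 0 < t) =>
      smul_ne_zero ht.ne' he0
  refine h.congr fun t (ht : 0 < t) => ?_
  rw [huf _ (smul_ne_zero ht.ne' he0), norm_smul, he, mul_one, Real.norm_of_nonneg ht.le]

theorem hasFDerivAt_norm_of_ne_zero {x : E} (hx : x ≠ 0) :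
    HasFDerivAt (fun y : E => ‖y‖) (‖x‖⁻¹ • innerSL ℝ x) x := by
  have h := (hasStrictFDerivAt_norm_sq x).hasFDerivAt.sqrt (pow_ne_zero 2 (norm_ne_zero_iff.2 hx))
  simp only [Real.sqrt_sq (norm_nonneg _)] at h
  refine h.congr_fderiv ?_
  rw [← Nat.cast_smul_eq_nsmul ℝ, smul_smul]
  congr 1
  have := norm_ne_zero_iff.2 hx
  field_simp
  norm_num

theorem hasFDerivAt_radial (hf : DifferentiableOn ℝ f (Set.Ioi 0))
    (huf : ∀ x, x ≠ 0 → u x = f ‖x‖) {x : E} (hx : x ≠ 0) :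
    HasFDerivAt u ((deriv f ‖x‖ / ‖x‖) • innerSL ℝ x) x := by
  have hx' : 0 < ‖x‖ := norm_pos_iff.2 hx
  have hd := (hf.differentiableAt (Ioi_mem_nhds hx')).hasDerivAt
  have h := hd.comp_hasFDerivAt x (hasFDerivAt_norm_of_ne_zero hx)
  rw [smul_smul, ← div_eq_mul_inv] at h
  exact h.congr_of_eventuallyEq ((isOpen_ne.eventually_mem hx).mono fun y hy => huf y hy)

/-- The gradient is (f'(|x|)/|x|) x; differentiate once more and take the trace, using Parseval for
x. -/
theorem laplacian_radial [FiniteDimensional ℝ E] (hf : ContDiffOn ℝ 2 f (Set.Ioi 0))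
    (huf : ∀ x, x ≠ 0 → u x = f ‖x‖) {x : E} (hx : x ≠ 0) :
    Δ u x = deriv (deriv f) ‖x‖ + ((Module.finrank ℝ E : ℝ) - 1) / ‖x‖ * deriv f ‖x‖ := by
  have hx' : 0 < ‖x‖ := norm_pos_iff.2 hx
  have hf1 : DifferentiableOn ℝ f (Set.Ioi 0) := hf.differentiableOn (by norm_num)
  have hf2 : DifferentiableOn ℝ (deriv f) (Set.Ioi 0) :=
    (hf.deriv_of_isOpen (m := 1) isOpen_Ioi (by norm_num)).differentiableOn (by norm_num)
  have hd := (hf2.differentiableAt (Ioi_mem_nhds hx')).hasDerivAt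
  have hq := (hd.div (hasDerivAt_id' ‖x‖) hx'.ne').comp_hasFDerivAt x
    (hasFDerivAt_norm_of_ne_zero hx)
  -- `innerSL ℝ` is typed as conjugate-linear in its first argument; `I` is the same map typed as
  -- ℝ-linear.
  obtain ⟨I, hI⟩ : ∃ I : E →L[ℝ] E →L[ℝ] ℝ, ∀ y, I y = innerSL ℝ y := ⟨innerSL ℝ, fun _ => rfl⟩
  have h2 := hq.smul I.hasFDerivAt
  have h3 : fderiv ℝ u =ᶠ[nhds x] fun y => (deriv f ‖y‖ / ‖y‖) • I y :=
    (isOpen_ne.eventually_mem hx).mono fun y hy => by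
      simp only [hI, (hasFDerivAt_radial hf1 huf hy).fderiv]
  have h4 := (h2.congr_of_eventuallyEq h3).fderiv
  let b := stdOrthonormalBasis ℝ E
  have h5 : ∀ i, iteratedFDeriv ℝ 2 u x ![b i, b i] = deriv f ‖x‖ / ‖x‖
      + (deriv (deriv f) ‖x‖ * ‖x‖ - deriv f ‖x‖) / ‖x‖ ^ 2 * ‖x‖⁻¹ * inner ℝ x (b i) ^ 2 := by
    intro i
    rw [iteratedFDeriv_two_apply, h4]
    simp [hI, innerSL_apply_apply]
    ring
  rw [InnerProductSpace.laplacian_eq_iteratedFDeriv_orthonormalBasis u b]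
  simp only [h5]
  rw [Finset.sum_add_distrib, ← Finset.mul_sum, Finset.sum_const, Finset.card_univ,
    Fintype.card_fin, nsmul_eq_mul]
  have h6 : ∑ i, inner ℝ x (b i) ^ 2 = ‖x‖ ^ 2 := by
    rw [← b.sum_sq_norm_inner_right x]
    simp [real_inner_comm]
  rw [h6]
  field_simp
  ring

end Radial

/-! ### From the function spaces on ℝ^N to weighted integrals of the profile. -/

theorem integrableOn_Ioi_rpow_mul_of_integrable_norm {N : ℕ} (hN : 1 ≤ N) {h : ℝ → ℝ}
    (hh : Integrable (fun x : EucSpace N => h ‖x‖)) :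
    IntegrableOn (fun r => r ^ ((N : ℝ) - 1) * h r) (Set.Ioi 0) := by
  have : Nonempty (Fin N) := ⟨⟨0, hN⟩⟩
  refine ((integrable_fun_norm_addHaar volume).1 hh).congr ?_
  refine (ae_restrict_iff' measurableSet_Ioi).2 (Filter.Eventually.of_forall fun r hr => ?_)
  simp only [finrank_euclideanSpace, Fintype.card_fin, smul_eq_mul]
  rw [← Real.rpow_natCast, Nat.cast_sub hN, Nat.cast_one]

/-- A weak gradient agrees almost everywhere with the classical one where the latter exists and is
continuous. -/
theorem HasWeakGradient.ae_innerSL_eq_fderiv {N : ℕ} {u : EucSpace N → ℝ}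
    {G : EucSpace N → EucSpace N} (h : HasWeakGradient u G) {U : Set (EucSpace N)} (hU : IsOpen U)
    (hu : ContDiffOn ℝ 1 u U) : ∀ᵐ x, x ∈ U → innerSL ℝ (G x) = fderiv ℝ u x := by
  obtain ⟨hul, hGl, hw⟩ := h
  have hud : ContinuousOn (fderiv ℝ u) U := hu.continuousOn_fderiv_of_isOpen hU le_rfl
  -- For test functions supported in U, classical integration by parts and the weak identity give
  -- the same integral; the fundamental lemma of the calculus of variations then applies.
  have key : ∀ v : EucSpace N, ∀ᵐ x, x ∈ U → inner ℝ (G x) v - fderiv ℝ u x v = 0 := by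
    intro v
    have hGv : LocallyIntegrable (fun x => inner ℝ (G x) v) := by
      intro x
      obtain ⟨s, hs, hsi⟩ := hGl x
      exact ⟨s, hs, hsi.inner_const v⟩
    have huv : ContinuousOn (fun x => fderiv ℝ u x v) U := hud.clm_apply continuousOn_const
    refine hU.ae_eq_zero_of_integral_contDiff_smul_eq_zero
      ((hGv.locallyIntegrableOn U).sub (huv.locallyIntegrableOn hU.measurableSet)) ?_
    intro φ hφ hφc hφU
    have hφd : Differentiable ℝ φ := hφ.differentiable (by simp)
    have hφ' : Continuous fun x => fderiv ℝ φ x v :=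
      (hφ.continuous_fderiv (by simp)).clm_apply continuous_const
    have i1 : Integrable fun x => fderiv ℝ u x v * φ x := by
      refine Continuous.integrable_of_hasCompactSupport ?_ hφc.mul_left
      exact (huv.mul hφ.continuous.continuousOn).continuous_of_tsupport_subset hU
        ((tsupport_mul_subset_right).trans hφU)
    have hφc' : HasCompactSupport fun x => fderiv ℝ φ x v :=
      (hφc.fderiv ℝ).comp_left (g := fun L : EucSpace N →L[ℝ] ℝ => L v) rfl
    have i2 : Integrable fun x => u x * fderiv ℝ φ x v := by
      simpa [mul_comm] using hul.integrable_smul_left_of_hasCompactSupport hφ' hφc'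
    have i3 : Integrable fun x => u x * φ x := by
      simpa [mul_comm] using hul.integrable_smul_left_of_hasCompactSupport hφ.continuous hφc
    have i4 : Integrable fun x => inner ℝ (G x) v * φ x := by
      simpa [mul_comm] using hGv.integrable_smul_left_of_hasCompactSupport hφ.continuous hφc
    have h1 := integral_mul_fderiv_eq_neg_fderiv_mul_of_integrable i1 i2 i3
      (fun x hx => (hu.differentiableOn one_ne_zero).differentiableAt (hU.mem_nhds (hφU hx)))
      (fun x _ => hφd x)
    have h2 := hw φ hφ hφc v
    calc ∫ x, φ x • (inner ℝ (G x) v - fderiv ℝ u x v)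
        = ∫ x, (inner ℝ (G x) v * φ x - fderiv ℝ u x v * φ x) := by
          congr 1; ext x; simp; ring
      _ = 0 := by rw [integral_sub i4 i1]; linarith
  have hall := ae_all_iff.2 fun i => key (EuclideanSpace.basisFun (Fin N) ℝ i)
  filter_upwards [hall] with x hx hxU
  refine ContinuousLinearMap.coe_injective
    ((EuclideanSpace.basisFun (Fin N) ℝ).toBasis.ext fun i => ?_)
  simpa [innerSL_apply_apply, sub_eq_zero] using hx i hxU

theorem IsClassicalSolution.isRadialProfile {N : ℕ} (hN : 3 ≤ N) {A α p : ℝ} {u : EucSpace N → ℝ}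
    {f : ℝ → ℝ} (h : IsClassicalSolution A α p u) (huf : ∀ x, x ≠ 0 → u x = f ‖x‖) :
    IsRadialProfile N A α p f (deriv f) := by
  let e : EucSpace N := EuclideanSpace.single ⟨0, by omega⟩ 1
  have he : ‖e‖ = 1 := by simp [e]
  have he0 : e ≠ 0 := by intro h0; simp [h0] at he
  have hf := contDiffOn_profile he h.contDiffOn huf
  have hnorm : ∀ r : ℝ, 0 < r → ‖r • e‖ = r := fun r hr => by
    rw [norm_smul, he, mul_one, Real.norm_of_nonneg hr.le]
  have hne : ∀ r : ℝ, 0 < r → r • e ≠ 0 := fun r hr => smul_ne_zero hr.ne' he0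
  have hu : ∀ r : ℝ, 0 < r → u (r • e) = f r := fun r hr => by rw [huf _ (hne r hr), hnorm r hr]
  refine ⟨fun r hr => hu r hr ▸ h.pos _ (hne r hr), fun r hr => ?_, fun r hr => ?_⟩
  · exact ((hf.differentiableOn (by norm_num)).differentiableAt (Ioi_mem_nhds hr)).hasDerivAt
  · have hf2 : DifferentiableOn ℝ (deriv f) (Set.Ioi 0) :=
      (hf.deriv_of_isOpen (m := 1) isOpen_Ioi (by norm_num)).differentiableOn (by norm_num)
    refine (hf2.differentiableAt (Ioi_mem_nhds hr)).hasDerivAt.congr_deriv ?_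
    have heq := h.equation _ (hne r hr)
    rw [laplacian_radial hf huf (hne r hr), hnorm r hr, hu r hr, finrank_euclideanSpace,
      Fintype.card_fin, div_eq_mul_inv A, ← Real.rpow_neg hr.le] at heq
    linarith

theorem integrable_norm_deriv_sq {N : ℕ} (hN : 3 ≤ N) {u : EucSpace N → ℝ} {f : ℝ → ℝ}
    (hu : ContDiffOn ℝ 2 u {0}ᶜ) (huD : MemD12 u) (huf : ∀ x, x ≠ 0 → u x = f ‖x‖) :
    Integrable fun x : EucSpace N => deriv f ‖x‖ ^ 2 := by
  have : Nonempty (Fin N) := ⟨⟨0, by omega⟩⟩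
  let e : EucSpace N := EuclideanSpace.single ⟨0, by omega⟩ 1
  have hf := contDiffOn_profile (e := e) (by simp [e]) hu huf
  obtain ⟨-, G, hG, hG2⟩ := huD
  have hGi := hG2.integrable_norm_rpow (by simp) (by simp)
  refine hGi.congr ?_
  filter_upwards [hG.ae_innerSL_eq_fderiv isOpen_compl_singleton (hu.of_le (by norm_num)),
    compl_mem_ae_iff.2 (measure_singleton (0 : EucSpace N))] with x hx hx0
  have hx0' : x ≠ 0 := hx0
  have h1 := hx hx0
  rw [(hasFDerivAt_radial (hf.differentiableOn (by norm_num)) huf hx0').fderiv] at h1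
  have h2 : ‖G x‖ = |deriv f ‖x‖| := by
    rw [← innerSL_apply_norm (𝕜 := ℝ) (G x), h1, norm_smul, innerSL_apply_norm, norm_div, norm_norm,
      div_mul_cancel₀ _ (norm_ne_zero_iff.2 hx0'), Real.norm_eq_abs]
  simp [h2]

theorem integrable_norm_rpow_of_memL2Weighted {N : ℕ} (hN : 3 ≤ N) {α : ℝ} {u : EucSpace N → ℝ}
    {f : ℝ → ℝ} (hu : MemL2Weighted α u) (huf : ∀ x, x ≠ 0 → u x = f ‖x‖) :
    Integrable fun x : EucSpace N => ‖x‖ ^ (-α) * f ‖x‖ ^ 2 := by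
  have : Nonempty (Fin N) := ⟨⟨0, by omega⟩⟩
  have h1 := hu.integrable_norm_rpow (by simp) (by simp)
  rw [integrable_withDensity_iff_integrable_smul' (by fun_prop) (by simp)] at h1
  refine h1.congr ?_
  filter_upwards [compl_mem_ae_iff.2 (measure_singleton (0 : EucSpace N))] with x hx0
  rw [ENNReal.toReal_ofReal (by positivity), huf x hx0]
  simp

theorem integrable_norm_rpow_of_memLp {N : ℕ} (hN : 3 ≤ N) {p : ℝ} (hp : 0 < p)
    {u : EucSpace N → ℝ} {f : ℝ → ℝ} (hu : MemLp u (ENNReal.ofReal p))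
    (hpos : ∀ x, x ≠ 0 → 0 < u x) (huf : ∀ x, x ≠ 0 → u x = f ‖x‖) :
    Integrable fun x : EucSpace N => f ‖x‖ ^ p := by
  have : Nonempty (Fin N) := ⟨⟨0, by omega⟩⟩
  have h1 := hu.integrable_norm_rpow (by simpa using hp) (by simp)
  rw [ENNReal.toReal_ofReal hp.le] at h1
  refine h1.congr ?_
  filter_upwards [compl_mem_ae_iff.2 (measure_singleton (0 : EucSpace N))] with x hx0
  rw [Real.norm_of_nonneg (hpos x hx0).le, huf x hx0]

theorem theorem1 (N : ℕ) (hN : 3 ≤ N) (A α p : ℝ) (hA : 0 < A) (hα0 : 0 < α) (hα2 : α < 2)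
    (hp_lower : 2 * (N : ℝ) / ((N : ℝ) - α) < p)
    (hp_upper : p ≤ 2 * ((2 * (N : ℝ) - 2 + α) / (2 * (N : ℝ) - 2 - α))) :
    ¬ ∃ u : EucSpace N → ℝ, IsClassicalSolution A α p u ∧ IsRadial u := by
  rintro ⟨u, hu, f, huf⟩
  have hN' : (3 : ℝ) ≤ N := by exact_mod_cast hN
  -- The lower bound on p enters only through this consequence.
  have hp2 : 2 < p := by
    refine lt_of_le_of_lt ?_ hp_lower
    rw [le_div_iff₀ (by linarith)]
    linarith
  have hp : (2 * N - 2 - α) / 4 * (p - 2) ≤ α := by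
    rw [← mul_div_assoc, le_div_iff₀ (by linarith)] at hp_upper
    linarith
  have hN1 : 1 ≤ N := by omega
  exact (hu.isRadialProfile hN huf).false_of_integrableOn hN' hA hα0 hα2 hp2 hp
    (integrableOn_Ioi_rpow_mul_of_integrable_norm (h := fun r => deriv f r ^ 2) hN1
      (integrable_norm_deriv_sq hN hu.contDiffOn hu.memD12 huf))
    (integrableOn_Ioi_rpow_mul_of_integrable_norm (h := fun r => r ^ (-α) * f r ^ 2) hN1
      (integrable_norm_rpow_of_memL2Weighted hN hu.memL2Weighted huf))
    (integrableOn_Ioi_rpow_mul_of_integrable_norm (h := fun r => f r ^ p) hN1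
      (integrable_norm_rpow_of_memLp hN (by linarith) hu.memLp hu.pos huf))
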